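/- Let $M^n$ be a smooth Riemannian manifold and let $f\colon M^n\to\mathbb{R}^{n+p}$ be a smooth isometric immersion, with normal spaces $N_fM(x)=(f_*T_xM)^\perp$ and second fundamental form $\alpha\colon T_xM\times T_xM\to N_fM(x)$. For $\xi\in N_fM(x)$ let $A_\xi\colon T_xM\to T_xM$ be the shape operator, $\langle A_\xi X,Y\rangle=\langle\alpha(X,Y),\xi\rangle$. Let $L^l$ be a connected (nonempty, possibly only immersed) totally geodesic submanifold of $M^n$, that is, one whose second fundamental form in $M^n$ (with respect to the Levi-Civita connection of $M^n$) vanishes. Suppose that $\alpha$ is adapted to $(TL,\,TL^\perp\cap TM)$: at every point $x$ of $L$, both $T_xL$ and its orthogonal complement in $T_xM$ are preserved by $A_\xi$ for all $\xi\in N_fM(x)$. Then $f|_L$ admits a reduction of codimension to $p$: there is a totally geodesic submanifold of $\mathbb{R}^{n+p}$, i.e. an affine subspace, of dimension $l+p$ that contains $f(L)$. -/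

import Mathlib

open Bundle Manifold VectorField
open scoped ContDiff Manifold Topology InnerProductSpace

set_option linter.unusedSectionVars false

noncomputable section

/-! ### Symmetric bilinear forms, shape operators, adapted decompositions -/

section Algebra

variable {V W : Type*} [NormedAddCommGroup V] [InnerProductSpace ℝ V] [FiniteDimensional ℝ V]
  [NormedAddCommGroup W] [InnerProductSpace ℝ W]

/-- The endomorphism `A` of `V` with `⟪A X, Y⟫ = B (X, Y)`. -/
def rieszEnd (B : V →L[ℝ] V →L[ℝ] ℝ) : V →L[ℝ] V :=
  LinearMap.toContinuousLinearMap
    { toFun := fun X ↦ (InnerProductSpace.toDual ℝ V).symm (B X)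
      map_add' := by simp
      map_smul' := by simp }

@[simp]
theorem inner_rieszEnd (B : V →L[ℝ] V →L[ℝ] ℝ) (X Y : V) : ⟪rieszEnd B X, Y⟫_ℝ = B X Y := by
  simp [rieszEnd]

/-- The shape operator `A_ξ : V → V` of a bilinear form `α : V × V → W` with respect to `ξ : W`,
i.e. the linear map with `⟪A_ξ X, Y⟫ = ⟪α (X, Y), ξ⟫`. -/
def shapeOperator (α : V →L[ℝ] V →L[ℝ] W) (ξ : W) : V →L[ℝ] V :=
  rieszEnd ((ContinuousLinearMap.compL ℝ V W ℝ (innerSL ℝ ξ)) ∘L α)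

theorem inner_shapeOperator (α : V →L[ℝ] V →L[ℝ] W) (ξ : W) (X Y : V) :
    ⟪shapeOperator α ξ X, Y⟫_ℝ = ⟪α X Y, ξ⟫_ℝ := by
  rw [shapeOperator, inner_rieszEnd, real_inner_comm]
  simp

/-- `α` is adapted to the family `E` of subspaces (in practice, an orthogonal decomposition of `V`):
every member of the family is preserved by all shape operators of `α`. -/
def IsAdapted {κ : Type*} (α : V →L[ℝ] V →L[ℝ] W) (E : κ → Submodule ℝ V) : Prop :=
  ∀ (i : κ) (ξ : W), ∀ X ∈ E i, shapeOperator α ξ X ∈ E i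

end Algebra

/-! ### The Levi-Civita connection of a Riemannian manifold -/

section LeviCivita

variable {E : Type*} [NormedAddCommGroup E] [NormedSpace ℝ E] [FiniteDimensional ℝ E]
  {H : Type*} [TopologicalSpace H] {I : ModelWithCorners ℝ E H}
  {M : Type*} [TopologicalSpace M] [ChartedSpace H M]

instance instFiniteDimensionalTangentSpace (x : M) : FiniteDimensional ℝ (TangentSpace I x) :=
  inferInstanceAs (FiniteDimensional ℝ E)

variable [RiemannianBundle (fun x : M ↦ TangentSpace I x)]

variable (I) in
/-- The right-hand side of the Koszul formula for `2 ⟪∇_X Y, Z⟫`, at the point `x`. -/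
def koszul (X Y Z : Π x : M, TangentSpace I x) (x : M) : ℝ :=
  d% (fun x' ↦ ⟪Y x', Z x'⟫_ℝ) x (X x) + d% (fun x' ↦ ⟪X x', Z x'⟫_ℝ) x (Y x)
    - d% (fun x' ↦ ⟪X x', Y x'⟫_ℝ) x (Z x)
    + ⟪mlieBracket I X Y x, Z x⟫_ℝ - ⟪mlieBracket I X Z x, Y x⟫_ℝ - ⟪mlieBracket I Y Z x, X x⟫_ℝ

theorem mdiffAt_inner [IsManifold I 1 M]
    [IsContMDiffRiemannianBundle I 1 E (fun x : M ↦ TangentSpace I x)]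
    {Y Z : Π x : M, TangentSpace I x} {x : M} (hY : MDiffAt (T% Y) x) (hZ : MDiffAt (T% Z) x) :
    MDiffAt (fun x' ↦ ⟪Y x', Z x'⟫_ℝ) x :=
  MDifferentiableAt.inner_bundle (F := E) (E := fun x : M ↦ TangentSpace I x) (b := id) hY hZ

variable [IsManifold I ∞ M] [IsContMDiffRiemannianBundle I ∞ E (fun x : M ↦ TangentSpace I x)]

theorem koszul_tensorial_left {Y Z : Π x : M, TangentSpace I x} {x : M}
    (hY : MDiffAt (T% Y) x) (hZ : MDiffAt (T% Z) x) :
    TensorialAt I E (fun X ↦ koszul I X Y Z x) x where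
  smul {g X} hg hX := by
    have h1 := mvfderiv_fun_mul hg (mdiffAt_inner hX hZ)
    have h2 := mvfderiv_fun_mul hg (mdiffAt_inner hX hY)
    simp only [koszul, Pi.smul_apply', real_inner_smul_left, h1, h2,
      mlieBracket_smul_left hg hX, inner_add_left, inner_smul_right, add_apply, smul_apply,
      map_smul, smul_eq_mul, real_inner_comm (Y x) (X x)]
    ring
  add hX hX' := by
    simp [koszul, inner_add_left, inner_add_right,
      mvfderiv_fun_add (mdiffAt_inner hX hZ) (mdiffAt_inner hX' hZ),
      mvfderiv_fun_add (mdiffAt_inner hX hY) (mdiffAt_inner hX' hY), mlieBracket_add_left hX hX']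
    ring

theorem koszul_tensorial_right {X Y : Π x : M, TangentSpace I x} {x : M}
    (hX : MDiffAt (T% X) x) (hY : MDiffAt (T% Y) x) :
    TensorialAt I E (fun Z ↦ koszul I X Y Z x) x where
  smul {g Z} hg hZ := by
    have h1 := mvfderiv_fun_mul hg (mdiffAt_inner hX hZ)
    have h2 := mvfderiv_fun_mul hg (mdiffAt_inner hY hZ)
    simp only [koszul, Pi.smul_apply', real_inner_smul_left, h1, h2,
      mlieBracket_smul_right hg hZ, inner_add_left, inner_smul_right, add_apply, smul_apply,
      map_smul, smul_eq_mul, real_inner_comm (Z x)]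
    ring
  add hZ hZ' := by
    simp [koszul, inner_add_left, inner_add_right,
      mvfderiv_fun_add (mdiffAt_inner hX hZ) (mdiffAt_inner hX hZ'),
      mvfderiv_fun_add (mdiffAt_inner hY hZ) (mdiffAt_inner hY hZ'), mlieBracket_add_right hZ hZ']
    ring

open Classical in
/-- The Levi-Civita connection as an operator: if the vector field `Y` is differentiable at `x`,
`leviCivitaAux Y x v` is the vector `∇_v Y` determined by the Koszul formula. -/
def leviCivitaAux (Y : Π x : M, TangentSpace I x) (x : M) :
    TangentSpace I x →L[ℝ] TangentSpace I x :=
  if hY : MDiffAt (T% Y) x then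
    (1 / 2 : ℝ) •
      rieszEnd (TensorialAt.mkHom₂ (F := E) (F' := E) (fun X Z ↦ koszul I X Y Z x) x
        (fun _ hZ ↦ koszul_tensorial_left hY hZ) (fun _ hX ↦ koszul_tensorial_right hX hY))
  else 0

theorem inner_leviCivitaAux {X Y Z : Π x : M, TangentSpace I x} {x : M}
    (hX : MDiffAt (T% X) x) (hY : MDiffAt (T% Y) x) (hZ : MDiffAt (T% Z) x) :
    ⟪leviCivitaAux Y x (X x), Z x⟫_ℝ = koszul I X Y Z x / 2 := by
  have := TensorialAt.mkHom₂_apply (F := E) (F' := E) (Φ := fun X Z ↦ koszul I X Y Z x)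
    (fun _ hZ ↦ koszul_tensorial_left hY hZ) (fun _ hX ↦ koszul_tensorial_right hX hY) hX hZ
  rw [leviCivitaAux, dif_pos hY, ← this]
  simp [inner_smul_left]
  ring

theorem leviCivitaAux_eq {Y : Π x : M, TangentSpace I x} {x : M}
    (hY : MDiffAt (T% Y) x) {B : TangentSpace I x →L[ℝ] TangentSpace I x}
    (h : ∀ X Z : Π x : M, TangentSpace I x, MDiffAt (T% X) x → MDiffAt (T% Z) x →
      ⟪B (X x), Z x⟫_ℝ = koszul I X Y Z x / 2) : leviCivitaAux Y x = B := by
  ext1 v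
  refine ext_inner_right ℝ fun w ↦ ?_
  have hv := FiberBundle.mdifferentiableAt_extend I E (V := fun x : M ↦ TangentSpace I x) v
  have hw := FiberBundle.mdifferentiableAt_extend I E (V := fun x : M ↦ TangentSpace I x) w
  have h1 := inner_leviCivitaAux hv hY hw
  rw [← h _ _ hv hw] at h1
  simpa using h1

variable (I M) in
/-- The Levi-Civita connection of a Riemannian manifold. -/
def leviCivita : CovariantDerivative I E (fun x : M ↦ TangentSpace I x) where
  toFun := leviCivitaAux
  isCovariantDerivativeOnUniv :=
    { add := by
        intro Y Y' x hY hY' _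
        refine leviCivitaAux_eq (mdifferentiableAt_add_section hY hY') fun X Z hX hZ ↦ ?_
        simp [inner_add_left, inner_leviCivitaAux hX hY hZ, inner_leviCivitaAux hX hY' hZ]
        simp [koszul, inner_add_left, inner_add_right,
          mvfderiv_fun_add (mdiffAt_inner hX hY) (mdiffAt_inner hX hY'),
          mvfderiv_fun_add (mdiffAt_inner hY hZ) (mdiffAt_inner hY' hZ),
          mlieBracket_add_right hY hY', mlieBracket_add_left hY hY']
        ring
      leibniz := by
        intro Y g x hY hg _
        refine leviCivitaAux_eq (hg.smul_section hY) fun X Z hX hZ ↦ ?_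
        simp [inner_add_left, inner_smul_left, inner_leviCivitaAux hX hY hZ]
        have h1 := mvfderiv_fun_mul hg (mdiffAt_inner hX hY)
        have h2 := mvfderiv_fun_mul hg (mdiffAt_inner hY hZ)
        simp only [koszul, Pi.smul_apply', real_inner_smul_left, h1, h2,
          mlieBracket_smul_right hg hY, mlieBracket_smul_left hg hY, inner_add_left,
          inner_smul_right, add_apply, smul_apply,
          map_smul, smul_eq_mul, real_inner_comm (X x) (Y x)]
        ring }

theorem inner_leviCivita {X Y Z : Π x : M, TangentSpace I x} {x : M}
    (hX : MDiffAt (T% X) x) (hY : MDiffAt (T% Y) x) (hZ : MDiffAt (T% Z) x) :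
    ⟪leviCivita I M Y x (X x), Z x⟫_ℝ = koszul I X Y Z x / 2 :=
  inner_leviCivitaAux hX hY hZ

variable (I M) in
theorem leviCivita_torsion : (leviCivita I M).torsion = 0 := by
  rw [CovariantDerivative.torsion_eq_zero_iff]
  intro X Y x hX hY
  refine ext_inner_right ℝ fun w ↦ ?_
  have hw := FiberBundle.mdifferentiableAt_extend I E (V := fun x : M ↦ TangentSpace I x) w
  have h1 := inner_leviCivita hX hY hw
  have h2 := inner_leviCivita hY hX hw
  rw [FiberBundle.extend_apply_self] at h1 h2
  rw [inner_sub_left, h1, h2]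
  simp only [koszul, FiberBundle.extend_apply_self, real_inner_comm (Y _) (X _),
    mlieBracket_swap_apply (V := Y) (W := X), inner_neg_left]
  ring

theorem leviCivita_metric {X Y Z : Π x : M, TangentSpace I x} {x : M}
    (hX : MDiffAt (T% X) x) (hY : MDiffAt (T% Y) x) (hZ : MDiffAt (T% Z) x) :
    d% (fun x' ↦ ⟪Y x', Z x'⟫_ℝ) x (X x) =
      ⟪leviCivita I M Y x (X x), Z x⟫_ℝ + ⟪Y x, leviCivita I M Z x (X x)⟫_ℝ := by
  rw [inner_leviCivita hX hY hZ, real_inner_comm, inner_leviCivita hX hZ hY]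
  simp only [koszul, real_inner_comm (Y _) (X _), real_inner_comm (Z _) (X _),
    real_inner_comm (Z _) (Y _),
    mlieBracket_swap_apply (V := Z) (W := Y), inner_neg_left]
  ring

end LeviCivita

/-! ### Isometric immersions into a Euclidean space -/

section Immersion

variable {E : Type*} [NormedAddCommGroup E] [NormedSpace ℝ E] [FiniteDimensional ℝ E]
  {H : Type*} [TopologicalSpace H] {I : ModelWithCorners ℝ E H}
  {M : Type*} [TopologicalSpace M] [ChartedSpace H M]
  {F : Type*} [NormedAddCommGroup F] [InnerProductSpace ℝ F] [FiniteDimensional ℝ F]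

variable (I) in
/-- The normal space `N_f M (x)`, the orthogonal complement of `f_* T_x M`. -/
def normalSpace (f : M → F) (x : M) : Submodule ℝ F := (LinearMap.range (d% f x).toLinearMap)ᗮ

variable [IsManifold I ∞ M]

theorem mdiffAt_pushforward {f : M → F} (hf : ContMDiff I 𝓘(ℝ, F) ∞ f)
    {Y : Π x : M, TangentSpace I x} {x : M} (hY : MDiffAt (T% Y) x) :
    MDiffAt (fun x' ↦ d% f x' (Y x')) x := by
  have h1 : ContMDiff I.tangent 𝓘(ℝ, F).tangent 1 (tangentMap I 𝓘(ℝ, F) f) :=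
    hf.contMDiff_tangentMap (by norm_cast)
  have h2 := (contMDiff_snd_tangentBundle_modelSpace F 𝓘(ℝ, F) (n := 1)).comp h1
  exact (h2.mdifferentiable one_ne_zero _).comp x hY

/-- The normal component at `x` of the derivative of `f_* Y` in the direction `X`; by the Gauss
formula this is the second fundamental form of `f` applied to the vector fields `X` and `Y`. -/
def gaussNormal (f : M → F) (X Y : Π x : M, TangentSpace I x) (x : M) : normalSpace I f x :=
  (normalSpace I f x).orthogonalProjectionOnto (d% (fun x' ↦ d% f x' (Y x')) x (X x))

theorem gaussNormal_tensorial_left (f : M → F) (Y : Π x : M, TangentSpace I x) (x : M) :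
    TensorialAt I E (fun X ↦ gaussNormal f X Y x) x where
  smul _ _ := by simp [gaussNormal]
  add _ _ := by simp [gaussNormal]

theorem gaussNormal_tensorial_right {f : M → F}
    (hf : ContMDiff I 𝓘(ℝ, F) ∞ f) (X : Π x : M, TangentSpace I x) (x : M) :
    TensorialAt I E (fun Y ↦ gaussNormal f X Y x) x where
  smul {g Y} hg hY := by
    have h1 := mvfderiv_smul hg (mdiffAt_pushforward hf hY)
    have h2 : (normalSpace I f x).orthogonalProjectionOnto (d% f x (Y x)) = 0 := by
      rw [Submodule.orthogonalProjectionOnto_eq_zero_iff]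
      exact Submodule.le_orthogonal_orthogonal _ (LinearMap.mem_range_self _ _)
    have h3 : (fun x' ↦ d% f x' ((g • Y) x')) = g • fun x' ↦ d% f x' (Y x') := by
      ext x'; simp
    rw [gaussNormal, h3, h1]
    simp [gaussNormal, h2]
  add {Y Y'} hY hY' := by
    have h1 := mvfderiv_add (mdiffAt_pushforward hf hY) (mdiffAt_pushforward hf hY')
    have h3 : (fun x' ↦ d% f x' ((Y + Y') x')) =
        (fun x' ↦ d% f x' (Y x')) + fun x' ↦ d% f x' (Y' x') := by
      ext x'; simp
    rw [gaussNormal, h3, h1]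
    simp [gaussNormal]

/-- The second fundamental form `α_x : T_x M × T_x M → N_f M (x)` of a smooth `f : M → F`. -/
def secondFundamentalForm (f : M → F) (hf : ContMDiff I 𝓘(ℝ, F) ∞ f) (x : M) :
    TangentSpace I x →L[ℝ] TangentSpace I x →L[ℝ] normalSpace I f x :=
  TensorialAt.mkHom₂ (F := E) (F' := E) (fun X Y ↦ gaussNormal f X Y x) x
    (fun _ _ ↦ gaussNormal_tensorial_left f _ x) (fun _ _ ↦ gaussNormal_tensorial_right hf _ x)

theorem secondFundamentalForm_apply {f : M → F}
    (hf : ContMDiff I 𝓘(ℝ, F) ∞ f) {X Y : Π x : M, TangentSpace I x} {x : M}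
    (hX : MDiffAt (T% X) x) (hY : MDiffAt (T% Y) x) :
    secondFundamentalForm f hf x (X x) (Y x) =
      (normalSpace I f x).orthogonalProjectionOnto (d% (fun x' ↦ d% f x' (Y x')) x (X x)) :=
  TensorialAt.mkHom₂_apply (F := E) (F' := E) (Φ := fun X Y ↦ gaussNormal f X Y x)
    (fun _ _ ↦ gaussNormal_tensorial_left f _ x) (fun _ _ ↦ gaussNormal_tensorial_right hf _ x)
    hX hY

variable (I) in
/-- `f : M → F` is a (smooth) isometric immersion of the Riemannian manifold `M`. -/
structure IsIsometricImmersion [RiemannianBundle (fun x : M ↦ TangentSpace I x)]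
    (f : M → F) : Prop where
  contMDiff : ContMDiff I 𝓘(ℝ, F) ∞ f
  inner_eq (x : M) (v w : TangentSpace I x) : ⟪d% f x v, d% f x w⟫_ℝ = ⟪v, w⟫_ℝ

/-- A map `g : L → F` from an `l`-dimensional manifold admits a reduction of codimension to `q`: its
image lies in a totally geodesic submanifold of `F` (that is, an affine subspace) of dimension
`l + q`. -/
def AdmitsReductionOfCodimension {L : Type*} (l : ℕ) (g : L → F) (q : ℕ) : Prop :=
  ∃ S : AffineSubspace ℝ F, (S : Set F).Nonempty ∧
    Module.finrank ℝ S.direction = l + q ∧ ∀ y : L, g y ∈ S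

end Immersion

/-! ### Totally geodesic submanifolds -/

section TotallyGeodesic

variable {E : Type*} [NormedAddCommGroup E] [NormedSpace ℝ E] [FiniteDimensional ℝ E]
  {H : Type*} [TopologicalSpace H] {I : ModelWithCorners ℝ E H}
  {M : Type*} [TopologicalSpace M] [ChartedSpace H M]
  {E' : Type*} [NormedAddCommGroup E'] [NormedSpace ℝ E']
  {H' : Type*} [TopologicalSpace H'] {J : ModelWithCorners ℝ E' H'}
  {L : Type*} [TopologicalSpace L] [ChartedSpace H' L]

variable (I J) in
/-- The tangent space at `y` of the submanifold `ι : L → M`, as a subspace of `T_{ι y} M`. -/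
def tangentSubspace (ι : L → M) (y : L) : Submodule ℝ (TangentSpace I (ι y)) :=
  LinearMap.range (mfderiv J I ι y).toLinearMap

variable (I J) in
/-- The immersed submanifold `ι : L → M` of the Riemannian manifold `M` is totally geodesic: its
second fundamental form in `M` vanishes, i.e. `∇_X Y` is tangent to `L` whenever `X` and `Y` are.
Here `Y` is a smooth vector field on an open subset of `M` that is tangent to `L` along a
neighbourhood of `y` in `L`, and `v` is the value of `X` at `y`. -/
def IsTotallyGeodesic [IsManifold I ∞ M] [RiemannianBundle (fun x : M ↦ TangentSpace I x)]
    [IsContMDiffRiemannianBundle I ∞ E (fun x : M ↦ TangentSpace I x)] (ι : L → M) : Prop :=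
  ∀ (y : L) (Y : Π x : M, TangentSpace I x),
    (∀ᶠ x in 𝓝 (ι y), ContMDiffAt I I.tangent ∞ (T% Y) x) →
    (∀ᶠ y' in 𝓝 y, Y (ι y') ∈ tangentSubspace I J ι y') →
    ∀ v ∈ tangentSubspace I J ι y, leviCivita I M Y (ι y) v ∈ tangentSubspace I J ι y

end TotallyGeodesic

end

/-! For `y` in `L` let `K y` be the image under `f_*` of the orthogonal complement of `T_yL` in
`TM`. This subspace of `F` does not depend on `y`. Indeed, let `η` be a field normal to `L` in `M`
and `X` tangent to `L`. The derivative of `f_* η` along `X` has no component along `f_* TL`, because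
`L` is totally geodesic and so `⟪η, ∇_X Y⟫ = 0` for every `Y` tangent to `L`. It has no component
normal to `f` either, because `⟪α(X, η), ξ⟫ = ⟪A_ξ X, η⟫` and `A_ξ X` is tangent to `L`. Hence it
stays in `K`. If `k` lies in the constant space `K`, then `⟪k, f⟫` has derivative zero along `L`,
since `f_* TL` is orthogonal to `K`. So `f(L)` lies in a translate of `Kᗮ`, whose dimension is `n +
p - (n - l) = l + p`.

No frames are chosen: `K` is represented by its orthogonal projection, the difference of the
projections onto `f_* TM` and `f_* TL`. `fderiv_starProjection_range_sub_eq_zero` is the linear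
algebra of its derivative. `inner_leviCivita_coordField` and `secondFundamentalForm_coordField` turn
the two geometric hypotheses into conditions on the second derivative of `f` in coordinates.
`mfderiv_pushforwardNormalProjection_eq_zero` combines these, and `eq_of_mfderiv_eq_zero` integrates
over the connected `L`. -/

noncomputable section

/-! ### Derivatives of families of orthogonal projections. -/

section Projections

variable {E E' F : Type*} [NormedAddCommGroup E] [InnerProductSpace ℝ E] [FiniteDimensional ℝ E]
  [NormedAddCommGroup E'] [InnerProductSpace ℝ E'] [FiniteDimensional ℝ E']
  [NormedAddCommGroup F] [InnerProductSpace ℝ F] [FiniteDimensional ℝ F]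

open ContinuousLinearMap in
theorem isInvertible_adjoint_comp_self {A : E →L[ℝ] F} (hA : Function.Injective A) :
    (adjoint A ∘L A).IsInvertible := by
  have hinj : Function.Injective (adjoint A ∘L A).toLinearMap := by
    rw [injective_iff_map_eq_zero]
    intro v hv
    have h : ⟪A v, A v⟫_ℝ = 0 := by
      rw [← adjoint_inner_left]
      exact (congrArg (fun z ↦ ⟪z, v⟫_ℝ) hv).trans (inner_zero_left _)
    exact hA ((inner_self_eq_zero.mp h).trans (map_zero A).symm)
  exact ⟨(LinearEquiv.ofInjectiveEndo _ hinj).toContinuousLinearEquiv, by ext; rfl⟩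

open ContinuousLinearMap in
/-- The orthogonal projection onto the range of an injective map, by the normal equations. -/
theorem starProjection_range_eq {A : E →L[ℝ] F} (hA : Function.Injective A) :
    A.range.starProjection = A ∘L (adjoint A ∘L A).inverse ∘L adjoint A := by
  ext1 x
  have hmem : A ((adjoint A ∘L A).inverse (adjoint A x)) ∈ A.range := ⟨_, rfl⟩
  refine Submodule.eq_starProjection_of_mem_of_inner_eq_zero hmem ?_
  rintro _ ⟨v, rfl⟩
  obtain ⟨e, he⟩ := isInvertible_adjoint_comp_self hA
  have h : (adjoint A) (A ((adjoint A ∘L A).inverse (adjoint A x))) = adjoint A x := by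
    rw [← he, inverse_equiv]
    exact (DFunLike.congr_fun he.symm _).trans (e.apply_symm_apply _)
  change ⟪x - A ((adjoint A ∘L A).inverse (adjoint A x)), A v⟫_ℝ = 0
  rw [← adjoint_inner_left, map_sub, h, sub_self, inner_zero_left]

theorem DifferentiableAt.clm_adjoint {G : Type*} [NormedAddCommGroup G] [NormedSpace ℝ G]
    {A : G → E →L[ℝ] F} {u : G} (hA : DifferentiableAt ℝ A u) :
    DifferentiableAt ℝ (fun u ↦ ContinuousLinearMap.adjoint (A u)) u := by
  have h : IsBoundedLinearMap ℝ (fun B : E →L[ℝ] F ↦ ContinuousLinearMap.adjoint B) :=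
    { map_add := by simp
      map_smul := by simp
      bound := ⟨1, one_pos, fun B ↦ by simp⟩ }
  exact h.differentiableAt.comp u hA

/-- The normal equations express the projection through `A`, its adjoint and an inverse, and
inversion is smooth at invertible maps. Injectivity is needed near `u` for the formula to hold near
`u`. -/
theorem differentiableAt_starProjection_range {G : Type*} [NormedAddCommGroup G] [NormedSpace ℝ G]
    {A : G → E →L[ℝ] F} {u : G} (hA : DifferentiableAt ℝ A u)
    (hinj : ∀ᶠ u' in 𝓝 u, Function.Injective (A u')) :
    DifferentiableAt ℝ (fun u ↦ (A u).range.starProjection) u := by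
  have h : DifferentiableAt ℝ (fun u ↦ A u ∘L
      (ContinuousLinearMap.adjoint (A u) ∘L A u).inverse ∘L
        ContinuousLinearMap.adjoint (A u)) u := by
    obtain ⟨e, he⟩ := isInvertible_adjoint_comp_self hinj.self_of_nhds
    have h1 : DifferentiableAt ℝ (fun u ↦ ContinuousLinearMap.adjoint (A u) ∘L A u) u :=
      hA.clm_adjoint.clm_comp hA
    have h2 : DifferentiableAt ℝ (ContinuousLinearMap.inverse : (E →L[ℝ] E) → E →L[ℝ] E)
        (ContinuousLinearMap.adjoint (A u) ∘L A u) := by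
      rw [← he]
      exact (contDiffAt_map_inverse (n := 1) e).differentiableAt one_ne_zero
    exact hA.clm_comp ((h2.comp u h1).clm_comp hA.clm_adjoint)
  exact h.congr_of_eventuallyEq (hinj.mono fun _ h ↦ starProjection_range_eq h)

/-- The derivative of the projection onto the range of `A u`, evaluated on the range. -/
theorem fderiv_starProjection_range_apply {G : Type*} [NormedAddCommGroup G] [NormedSpace ℝ G]
    {A : G → E →L[ℝ] F} {u : G} (hA : DifferentiableAt ℝ A u)
    (hinj : ∀ᶠ u' in 𝓝 u, Function.Injective (A u')) (b : G) (v : E) :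
    fderiv ℝ (fun u ↦ (A u).range.starProjection) u b (A u v) =
      fderiv ℝ A u b v - (A u).range.starProjection (fderiv ℝ A u b v) := by
  have hP := differentiableAt_starProjection_range hA hinj
  have h1 : (fun u ↦ (A u).range.starProjection ∘L A u) = A := by
    ext u v
    exact Submodule.starProjection_eq_self_iff.mpr ⟨v, rfl⟩
  have h2 := (hP.hasFDerivAt.clm_comp hA.hasFDerivAt).fderiv
  rw [h1] at h2
  have h3 := congr($h2 b v)
  simp only [add_apply, ContinuousLinearMap.comp_apply, ContinuousLinearMap.compL_apply,
    ContinuousLinearMap.flip_apply] at h3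
  exact eq_sub_of_add_eq' h3.symm

/-- Differentiate `P ∘ P = P`. -/
theorem fderiv_idempotent_add {G : Type*} [NormedAddCommGroup G] [NormedSpace ℝ G]
    {P : G → F →L[ℝ] F} {u : G} (hP : DifferentiableAt ℝ P u)
    (hid : ∀ u x, P u (P u x) = P u x) (b : G) (x : F) :
    fderiv ℝ P u b (P u x) + P u (fderiv ℝ P u b x) = fderiv ℝ P u b x := by
  have h1 : (fun u ↦ P u ∘L P u) = P := by
    ext u v
    exact hid u v
  have h2 := (hP.hasFDerivAt.clm_comp hP.hasFDerivAt).fderiv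
  rw [h1] at h2
  have h3 := congr($h2 b x)
  simp only [add_apply, ContinuousLinearMap.comp_apply, ContinuousLinearMap.compL_apply,
    ContinuousLinearMap.flip_apply] at h3
  rw [add_comm, ← h3]

theorem inner_fderiv_symmetric {G : Type*} [NormedAddCommGroup G] [NormedSpace ℝ G]
    {P : G → F →L[ℝ] F} {u : G} (hP : DifferentiableAt ℝ P u)
    (hs : ∀ u x y, ⟪P u x, y⟫_ℝ = ⟪x, P u y⟫_ℝ) (b : G) (x y : F) :
    ⟪fderiv ℝ P u b x, y⟫_ℝ = ⟪x, fderiv ℝ P u b y⟫_ℝ := by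
  have h1 := ((hP.hasFDerivAt.clm_apply (hasFDerivAt_const x u)).inner ℝ
    (hasFDerivAt_const y u)).fderiv
  have h2 := ((hasFDerivAt_const x u).inner ℝ
    (hP.hasFDerivAt.clm_apply (hasFDerivAt_const y u))).fderiv
  simp only [hs] at h1
  have h3 := congr($(h1.symm.trans h2) b)
  simpa using h3

/-- A differentiable family of orthogonal projections whose derivative vanishes on the range has
derivative zero. -/
theorem fderiv_projection_eq_zero {G : Type*} [NormedAddCommGroup G] [NormedSpace ℝ G]
    {P : G → F →L[ℝ] F} {u : G} (hP : DifferentiableAt ℝ P u)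
    (hid : ∀ u x, P u (P u x) = P u x) (hs : ∀ u x y, ⟪P u x, y⟫_ℝ = ⟪x, P u y⟫_ℝ)
    (h0 : ∀ b x, fderiv ℝ P u b (P u x) = 0) : fderiv ℝ P u = 0 := by
  ext1 b
  ext1 x
  refine ext_inner_right ℝ fun y ↦ ?_
  -- Since `P'P = 0`, this leaves `P' = PP'`, whence `⟪P'x, y⟫ = ⟪P'x, Py⟫ = ⟪x, P'Py⟫ = 0`.
  have h1 := fderiv_idempotent_add hP hid b x
  rw [h0, zero_add] at h1
  rw [← h1, hs, inner_fderiv_symmetric hP hs, h0]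
  simp

/-- Together with the next two lemmas: for `S ≤ T` the difference of the projections is the
orthogonal projection onto `T ⊓ Sᗮ`. -/
theorem starProjection_sub_apply_mem {S T : Submodule ℝ F} (h : S ≤ T) (x : F) :
    (T.starProjection - S.starProjection) x ∈ T ⊓ Sᗮ := by
  refine ⟨T.sub_mem (T.starProjection_apply_mem x) (h (S.starProjection_apply_mem x)), ?_⟩
  have h1 := Submodule.sub_mem _ (S.sub_starProjection_mem_orthogonal x)
    (Submodule.orthogonal_le h (T.sub_starProjection_mem_orthogonal x))
  simpa using h1

theorem starProjection_sub_eq_self {S T : Submodule ℝ F} {x : F} (hx : x ∈ T ⊓ Sᗮ) :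
    (T.starProjection - S.starProjection) x = x := by
  simp [Submodule.starProjection_eq_self_iff.mpr hx.1,
    (Submodule.starProjection_apply_eq_zero_iff _).mpr hx.2]

theorem starProjection_sub_symmetric (S T : Submodule ℝ F) (x y : F) :
    ⟪(T.starProjection - S.starProjection) x, y⟫_ℝ =
      ⟪x, (T.starProjection - S.starProjection) y⟫_ℝ := by
  simp [inner_sub_left, inner_sub_right, Submodule.inner_starProjection_left_eq_right]

/-- Let `A u : E → F` be injective and let `S u ≤ T u` be the images of `j : E' → E` and of `E`.
If the derivative of `A` maps `E'` into `S u ⊔ (T u)ᗮ` and the preimage of the orthogonal complement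
of `S u` into `T u`, then the orthogonal complement of `S u` in `T u` has derivative zero. -/
theorem fderiv_starProjection_range_sub_eq_zero {G : Type*} [NormedAddCommGroup G]
    [NormedSpace ℝ G] {A : G → E →L[ℝ] F} {u : G} (hA : DifferentiableAt ℝ A u)
    (hinj : ∀ᶠ u' in 𝓝 u, Function.Injective (A u')) {j : E' →L[ℝ] E}
    (hj : Function.Injective j)
    (htan : ∀ b v w, (∀ v', ⟪A u w, A u (j v')⟫_ℝ = 0) → ⟪fderiv ℝ A u b (j v), A u w⟫_ℝ = 0)
    (hnor : ∀ b w, (∀ v', ⟪A u w, A u (j v')⟫_ℝ = 0) → fderiv ℝ A u b w ∈ (A u).range) :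
    DifferentiableAt ℝ
        (fun u ↦ (A u).range.starProjection - (A u ∘L j).range.starProjection) u ∧
      fderiv ℝ (fun u ↦ (A u).range.starProjection - (A u ∘L j).range.starProjection) u = 0 := by
  have hAj : DifferentiableAt ℝ (fun u ↦ A u ∘L j) u := hA.clm_comp (differentiableAt_const j)
  have hinjj : ∀ᶠ u' in 𝓝 u, Function.Injective (A u' ∘L j) := hinj.mono fun u' h ↦ h.comp hj
  have hle (u) : (A u ∘L j).range ≤ (A u).range := by
    rintro _ ⟨v, rfl⟩
    exact ⟨j v, rfl⟩
  have hT := differentiableAt_starProjection_range hA hinj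
  have hS := differentiableAt_starProjection_range hAj hinjj
  have hQ : DifferentiableAt ℝ
    (fun u ↦ (A u).range.starProjection - (A u ∘L j).range.starProjection) u := hT.sub hS
  refine ⟨hQ, fderiv_projection_eq_zero hQ
    (fun u x ↦ starProjection_sub_eq_self (starProjection_sub_apply_mem (hle u) x))
    (fun u ↦ starProjection_sub_symmetric _ _) fun b x ↦ ?_⟩
  obtain ⟨⟨w, hw⟩, hk⟩ := starProjection_sub_apply_mem (hle u) x
  generalize ((A u).range.starProjection - (A u ∘L j).range.starProjection) x = k at hw hk
  have hw' : A u w = k := hw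
  have horth (v') : ⟪A u w, A u (j v')⟫_ℝ = 0 := by
    rw [hw', real_inner_comm]
    exact (Submodule.mem_orthogonal _ _).mp hk _ ⟨v', rfl⟩
  -- On `k = A w` the derivative is the part of `A' w` orthogonal to `T`, which `hnor` kills.
  have h1 : fderiv ℝ (fun u ↦ (A u).range.starProjection) u b k = 0 := by
    rw [← hw', fderiv_starProjection_range_apply hA hinj,
      Submodule.starProjection_eq_self_iff.mpr (hnor b w horth), sub_self]
  -- Write `P` for the projection onto `S`. As `P k = 0`, `P'k = P P'k`, so `⟪P'k, y⟫ = ⟪k, P'Py⟫`.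
  -- With `P y = A (j v)` and `k ⊥ S` this equals `⟪k, A'(j v)⟫`, which is zero by `htan`.
  have h2 : fderiv ℝ (fun u ↦ (A u ∘L j).range.starProjection) u b k = 0 := by
    refine ext_inner_right ℝ fun y ↦ ?_
    have h3 := fderiv_idempotent_add hS
      (fun u x ↦ (Submodule.starProjection_eq_self_iff.mpr
        (Submodule.starProjection_apply_mem _ x))) b k
    simp only [(Submodule.starProjection_apply_eq_zero_iff _).mpr hk, map_zero, zero_add] at h3
    obtain ⟨v, hv⟩ := (A u ∘L j).range.starProjection_apply_mem y
    have hv' : (A u ∘L j) v = (A u ∘L j).range.starProjection y := hv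
    have h4 : fderiv ℝ (fun u ↦ A u ∘L j) u b v = fderiv ℝ A u b (j v) := by
      rw [(hA.hasFDerivAt.clm_comp (hasFDerivAt_const j u)).fderiv]
      simp
    rw [← h3, Submodule.inner_starProjection_left_eq_right, inner_fderiv_symmetric hS
      (fun u ↦ Submodule.inner_starProjection_left_eq_right _), ← hv',
      fderiv_starProjection_range_apply hAj hinjj, inner_sub_right, h4,
      ← Submodule.inner_starProjection_left_eq_right,
      (Submodule.starProjection_apply_eq_zero_iff _).mpr hk, real_inner_comm, ← hw', htan b v w horth]
    simp
  rw [fderiv_fun_sub hT hS, sub_apply, sub_apply, h1, h2, sub_zero]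

end Projections

/-! ### Coordinate vector fields and the Gauss formula in coordinates. -/

section CoordinateFields

variable {E : Type*} [NormedAddCommGroup E] [NormedSpace ℝ E] [FiniteDimensional ℝ E]
  {H : Type*} [TopologicalSpace H] {I : ModelWithCorners ℝ E H}
  {M : Type*} [TopologicalSpace M] [ChartedSpace H M]

variable (I) in
/-- `φ` is smooth at `x` with invertible derivative. -/
structure IsCoordinateAt (φ : M → E) (x : M) : Prop where
  contMDiffAt : ContMDiffAt I 𝓘(ℝ, E) ∞ φ x
  isInvertible : (mfderiv I 𝓘(ℝ, E) φ x).IsInvertible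

/-- The constant vector field `v` on the model space. -/
def constField (v : E) : Π z : E, TangentSpace 𝓘(ℝ, E) z := fun _ ↦ v

variable (I) in
/-- The vector field whose coordinates with respect to `φ` are the constant `v`. -/
def coordField (φ : M → E) (v : E) : Π x : M, TangentSpace I x :=
  mpullback I 𝓘(ℝ, E) φ (constField v)

variable {φ : M → E} {x : M}

theorem IsCoordinateAt.mdifferentiableAt (h : IsCoordinateAt I φ x) :
    MDifferentiableAt I 𝓘(ℝ, E) φ x :=
  h.contMDiffAt.mdifferentiableAt (by simp)

theorem IsCoordinateAt.mfderiv_coordField (h : IsCoordinateAt I φ x) (v : E) :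
    mfderiv I 𝓘(ℝ, E) φ x (coordField I φ v x) = v := by
  obtain ⟨e, he⟩ := h.isInvertible
  rw [coordField, mpullback_apply, ← he, ContinuousLinearMap.inverse_equiv]
  exact e.apply_symm_apply _

theorem IsCoordinateAt.coordField_mfderiv (h : IsCoordinateAt I φ x) (w : TangentSpace I x) :
    coordField I φ (mfderiv I 𝓘(ℝ, E) φ x w) x = w := by
  obtain ⟨e, he⟩ := h.isInvertible
  change (mfderiv I 𝓘(ℝ, E) φ x).inverse (mfderiv I 𝓘(ℝ, E) φ x w) = w
  rw [← he, ContinuousLinearMap.inverse_equiv]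
  exact e.symm_apply_apply _

theorem contMDiffAt_constField (v z : E) :
    ContMDiffAt 𝓘(ℝ, E) 𝓘(ℝ, E).tangent ∞ (T% (constField v)) z := by
  rw [contMDiffAt_vectorSpace_iff_contDiffAt]
  exact contDiffAt_const

theorem mlieBracket_constField (v w : E) :
    mlieBracket 𝓘(ℝ, E) (constField v) (constField w) = 0 := by
  rw [← mlieBracketWithin_univ, mlieBracketWithin_eq_lieBracketWithin]
  ext z
  change lieBracketWithin ℝ (fun _ : E ↦ v) (fun _ : E ↦ w) Set.univ z = 0
  simp [lieBracketWithin]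

variable [IsManifold I ∞ M]

theorem IsCoordinateAt.contMDiffAt_coordField (h : IsCoordinateAt I φ x) (v : E) :
    ContMDiffAt I I.tangent ∞ (T% (coordField I φ v)) x :=
  ContMDiffAt.mpullback_vectorField_preimage (contMDiffAt_constField v (φ x))
    h.contMDiffAt h.isInvertible (by simp)

theorem IsCoordinateAt.mdiffAt_coordField (h : IsCoordinateAt I φ x) (v : E) :
    MDiffAt (T% (coordField I φ v)) x :=
  (h.contMDiffAt_coordField v).mdifferentiableAt (by simp)

/-- Brackets commute with pullback and constant fields commute. This removes the bracket terms from
the Koszul formula. -/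
theorem IsCoordinateAt.mlieBracket_coordField (h : IsCoordinateAt I φ x) (v w : E) :
    mlieBracket I (coordField I φ v) (coordField I φ w) x = 0 := by
  have hV (v : E) := (contMDiffAt_constField v (φ x)).mdifferentiableAt
    (n := ∞) (by simp)
  have : IsManifold I (minSmoothness ℝ 3) M := by
    rw [minSmoothness_of_isRCLikeNormedField]
    exact IsManifold.of_le (n := ∞) ENat.LEInfty.out
  have h1 := mpullback_mlieBracket (hV v) (hV w) h.contMDiffAt
    (by rw [minSmoothness_of_isRCLikeNormedField]; exact ENat.LEInfty.out)
  rw [coordField, coordField, ← h1, mlieBracket_constField]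
  simp

variable {F : Type*} [NormedAddCommGroup F] [InnerProductSpace ℝ F] [FiniteDimensional ℝ F]
  {f : M → F} {h : E → F}

theorem IsCoordinateAt.mvfderiv_comp {G : Type*} [NormedAddCommGroup G] [NormedSpace ℝ G]
    (hφ : IsCoordinateAt I φ x) {g : E → G} (hg : DifferentiableAt ℝ g (φ x)) :
    MDiffAt (fun x' ↦ g (φ x')) x ∧
    ∀ v, d% (fun x' ↦ g (φ x')) x (coordField I φ v x) = fderiv ℝ g (φ x) v := by
  refine ⟨hg.mdifferentiableAt.comp x hφ.mdifferentiableAt, fun v ↦ ?_⟩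
  have h1 : mfderiv I 𝓘(ℝ, G) (g ∘ φ) x = _ := mfderiv_comp x hg.mdifferentiableAt
    hφ.mdifferentiableAt
  rw [mfderiv_eq_fderiv] at h1
  have h2 := congr($h1 (coordField I φ v x))
  refine h2.trans ?_
  exact congrArg (fderiv ℝ g (φ x)) (hφ.mfderiv_coordField v)

theorem mvfderiv_congr {G : Type*} [NormedAddCommGroup G] [NormedSpace ℝ G] {g g' : M → G}
    (hg : g =ᶠ[𝓝 x] g') : d% g x = d% g' x := by
  ext v
  exact congr($(hg.mfderiv_eq (I := I) (I' := 𝓘(ℝ, G))) v)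

theorem IsCoordinateAt.mvfderiv_coordField (hφ : IsCoordinateAt I φ x)
    (hf : f =ᶠ[𝓝 x] h ∘ φ) (hh : DifferentiableAt ℝ h (φ x)) (v : E) :
    d% f x (coordField I φ v x) = fderiv ℝ h (φ x) v := by
  rw [mvfderiv_congr hf]
  exact (hφ.mvfderiv_comp hh).2 v

theorem eventually_mvfderiv_coordField (hφ : ∀ᶠ x' in 𝓝 x, IsCoordinateAt I φ x')
    (hf : f =ᶠ[𝓝 x] h ∘ φ) (hh : ContDiffAt ℝ ∞ h (φ x)) (v : E) :
    (fun x' ↦ d% f x' (coordField I φ v x')) =ᶠ[𝓝 x] fun x' ↦ fderiv ℝ h (φ x') v := by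
  have h1 := hφ.self_of_nhds.contMDiffAt.continuousAt.eventually
    ((hh.of_le (m := 1) (by exact_mod_cast le_top)).eventually (by simp))
  filter_upwards [hφ, hf.eventuallyEq_nhds, h1] with x' h2 h3 h4
  exact h2.mvfderiv_coordField h3 (h4.differentiableAt one_ne_zero) v

theorem ContDiffAt.differentiableAt_fderiv {z : E} (hh : ContDiffAt ℝ ∞ h z) :
    DifferentiableAt ℝ (fderiv ℝ h) z :=
  (hh.fderiv_right (m := 1) (by norm_cast)).differentiableAt one_ne_zero

/-- The second derivative of `f` along coordinate vector fields. -/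
theorem mvfderiv_mvfderiv_coordField (hφ : ∀ᶠ x' in 𝓝 x, IsCoordinateAt I φ x')
    (hf : f =ᶠ[𝓝 x] h ∘ φ) (hh : ContDiffAt ℝ ∞ h (φ x)) (b v : E) :
    d% (fun x' ↦ d% f x' (coordField I φ v x')) x (coordField I φ b x) =
      fderiv ℝ (fderiv ℝ h) (φ x) b v := by
  have hd := hh.differentiableAt_fderiv
  rw [mvfderiv_congr (eventually_mvfderiv_coordField hφ hf hh v),
    (hφ.self_of_nhds.mvfderiv_comp (g := fun z ↦ fderiv ℝ h z v)
      (hd.clm_apply (differentiableAt_const v))).2, fderiv_clm_apply hd (differentiableAt_const v)]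
  simp

section Riemannian

variable [RiemannianBundle (fun x : M ↦ TangentSpace I x)]
  [IsContMDiffRiemannianBundle I ∞ E (fun x : M ↦ TangentSpace I x)]

/-- Because `f` is isometric, the metric coefficients near `x` are `⟪Dh v, Dh w⟫`, to which the
product rule applies. -/
theorem mvfderiv_inner_coordField (hφ : ∀ᶠ x' in 𝓝 x, IsCoordinateAt I φ x')
    (hiso : IsIsometricImmersion I f) (hf : f =ᶠ[𝓝 x] h ∘ φ) (hh : ContDiffAt ℝ ∞ h (φ x))
    (b v w : E) :
    d% (fun x' ↦ ⟪coordField I φ v x', coordField I φ w x'⟫_ℝ) x (coordField I φ b x) =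
      ⟪fderiv ℝ h (φ x) v, fderiv ℝ (fderiv ℝ h) (φ x) b w⟫_ℝ +
        ⟪fderiv ℝ (fderiv ℝ h) (φ x) b v, fderiv ℝ h (φ x) w⟫_ℝ := by
  have h1 : (fun x' ↦ ⟪coordField I φ v x', coordField I φ w x'⟫_ℝ) =ᶠ[𝓝 x]
      fun x' ↦ ⟪fderiv ℝ h (φ x') v, fderiv ℝ h (φ x') w⟫_ℝ := by
    filter_upwards [eventually_mvfderiv_coordField hφ hf hh v,
      eventually_mvfderiv_coordField hφ hf hh w] with x' h1 h2
    rw [← hiso.inner_eq, h1, h2]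
  have hd (v : E) : DifferentiableAt ℝ (fun z ↦ fderiv ℝ h z v) (φ x) :=
    (hh.differentiableAt_fderiv).clm_apply (differentiableAt_const v)
  rw [mvfderiv_congr h1, (hφ.self_of_nhds.mvfderiv_comp
    (g := fun z ↦ ⟪fderiv ℝ h z v, fderiv ℝ h z w⟫_ℝ) ((hd v).inner ℝ (hd w))).2,
    fderiv_inner_apply ℝ (hd v) (hd w)]
  simp [fderiv_clm_apply (hh.differentiableAt_fderiv) (differentiableAt_const _)]

/-- The tangential part of the Gauss formula for coordinate vector fields. -/
theorem inner_leviCivita_coordField (hφ : ∀ᶠ x' in 𝓝 x, IsCoordinateAt I φ x')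
    (hiso : IsIsometricImmersion I f) (hf : f =ᶠ[𝓝 x] h ∘ φ) (hh : ContDiffAt ℝ ∞ h (φ x))
    (b v w : E) :
    ⟪leviCivita I M (coordField I φ v) x (coordField I φ b x), coordField I φ w x⟫_ℝ =
      ⟪fderiv ℝ (fderiv ℝ h) (φ x) b v, fderiv ℝ h (φ x) w⟫_ℝ := by
  have hx := hφ.self_of_nhds
  have hsymm (b v : E) : fderiv ℝ (fderiv ℝ h) (φ x) b v = fderiv ℝ (fderiv ℝ h) (φ x) v b :=
    (hh.isSymmSndFDerivAt (by simp; exact ENat.LEInfty.out)) b v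
  rw [inner_leviCivita (hx.mdiffAt_coordField b) (hx.mdiffAt_coordField v)
    (hx.mdiffAt_coordField w), koszul]
  -- Six terms in `D²h` remain. By its symmetry four cancel in pairs and the other two agree.
  simp only [mvfderiv_inner_coordField hφ hiso hf hh, hx.mlieBracket_coordField, inner_zero_left]
  rw [hsymm v b, hsymm w b, hsymm w v, real_inner_comm (fderiv ℝ (fderiv ℝ h) (φ x) v w),
    real_inner_comm (fderiv ℝ (fderiv ℝ h) (φ x) b w)]
  ring

end Riemannian

/-- The normal part of the Gauss formula for coordinate vector fields. -/
theorem secondFundamentalForm_coordField (hφ : ∀ᶠ x' in 𝓝 x, IsCoordinateAt I φ x')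
    (hfs : ContMDiff I 𝓘(ℝ, F) ∞ f) (hf : f =ᶠ[𝓝 x] h ∘ φ) (hh : ContDiffAt ℝ ∞ h (φ x))
    (b v : E) :
    secondFundamentalForm f hfs x (coordField I φ b x) (coordField I φ v x) =
      (normalSpace I f x).orthogonalProjectionOnto (fderiv ℝ (fderiv ℝ h) (φ x) b v) := by
  rw [secondFundamentalForm_apply hfs (hφ.self_of_nhds.mdiffAt_coordField b)
    (hφ.self_of_nhds.mdiffAt_coordField v), mvfderiv_mvfderiv_coordField hφ hf hh]

end CoordinateFields

/-! ### Charts as coordinates, and functions with zero derivative. -/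

section Charts

variable {E : Type*} [NormedAddCommGroup E] [NormedSpace ℝ E] [FiniteDimensional ℝ E]
  {H : Type*} [TopologicalSpace H] {I : ModelWithCorners ℝ E H} [I.Boundaryless]
  {M : Type*} [TopologicalSpace M] [ChartedSpace H M] [IsManifold I ∞ M]

theorem contMDiffAt_extend_symm {e : OpenPartialHomeomorph M H}
    (he : e ∈ IsManifold.maximalAtlas I ∞ M) {z : E} (hz : z ∈ (e.extend I).target) :
    ContMDiffAt 𝓘(ℝ, E) I ∞ (e.extend I).symm z :=
  ((contMDiffOn_extend_symm he).mono (by rw [I.image_eq, e.extend_target])).contMDiffAt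
    (e.isOpen_extend_target.mem_nhds hz)

theorem isCoordinateAt_extend {e : OpenPartialHomeomorph M H}
    (he : e ∈ IsManifold.maximalAtlas I ∞ M) {x : M} (hx : x ∈ e.source) :
    IsCoordinateAt I (e.extend I) x := by
  have hx' : x ∈ (e.extend I).source := by rwa [e.extend_source]
  have h1 := e.contMDiffAt_extend he hx
  have h2 := contMDiffAt_extend_symm he ((e.extend I).map_source hx')
  have d1 := h1.mdifferentiableAt (n := ∞) (by simp)
  have d2 := h2.mdifferentiableAt (n := ∞) (by simp)
  refine ⟨h1, ?_⟩
  have hl : (e.extend I).symm ∘ e.extend I =ᶠ[𝓝 x] id := by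
    filter_upwards [e.extend_source_mem_nhds (I := I) hx] with x' h
    exact (e.extend I).left_inv h
  have hr : e.extend I ∘ (e.extend I).symm =ᶠ[𝓝 (e.extend I x)] id := by
    filter_upwards [e.isOpen_extend_target.mem_nhds ((e.extend I).map_source hx')] with z h
    exact (e.extend I).right_inv h
  -- Differentiating both composites of the chart with its inverse shows that their derivatives are
  -- mutually inverse.
  have c1 := mfderiv_comp x d2 d1
  have hxx : (e.extend I).symm (e.extend I x) = x := (e.extend I).left_inv hx'
  have c2 := mfderiv_comp_of_eq d1 d2 hxx
  rw [hl.mfderiv_eq, mfderiv_id] at c1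
  rw [hr.mfderiv_eq, mfderiv_id] at c2
  refine ⟨ContinuousLinearEquiv.equivOfInverse (mfderiv I 𝓘(ℝ, E) (e.extend I) x)
    (mfderiv 𝓘(ℝ, E) I (e.extend I).symm (e.extend I x)) (fun v ↦ ?_) fun v ↦ ?_, rfl⟩
  · exact congr($c1.symm v)
  · rw [hxx] at c2
    exact congr($c2.symm v)

/-- A function with zero derivative on a connected manifold is constant. -/
theorem eq_of_mfderiv_eq_zero [PreconnectedSpace M] {G : Type*} [NormedAddCommGroup G]
    [NormedSpace ℝ G] {g : M → G} (hg : ∀ x, MDifferentiableAt I 𝓘(ℝ, G) g x)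
    (h0 : ∀ x, mfderiv I 𝓘(ℝ, G) g x = 0) (x y : M) : g x = g y := by
  refine IsLocallyConstant.apply_eq_of_isPreconnected (IsLocallyConstant.iff_eventually_eq _ |>.mpr
    fun x ↦ ?_) isPreconnected_univ (Set.mem_univ _) (Set.mem_univ _)
  set e := chartAt H x
  have he : e ∈ IsManifold.maximalAtlas I ∞ M := IsManifold.chart_mem_maximalAtlas x
  have hx : x ∈ (e.extend I).source := by
    rw [e.extend_source]
    exact mem_chart_source H x
  have hxe := hx
  rw [e.extend_source] at hxe
  -- Local constancy is read off on a ball in the chart, which is convex and hence connected.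
  obtain ⟨r, hr, hball⟩ := Metric.isOpen_iff.mp e.isOpen_extend_target _
    ((e.extend I).map_source hx)
  have hd (z) (hz : z ∈ (e.extend I).target) :
      DifferentiableAt ℝ (g ∘ (e.extend I).symm) z ∧
        fderiv ℝ (g ∘ (e.extend I).symm) z = 0 := by
    have d2 := (contMDiffAt_extend_symm he hz).mdifferentiableAt (n := ∞) (by simp)
    have h1 := (hg ((e.extend I).symm z)).comp z d2
    refine ⟨h1.differentiableAt, ?_⟩
    rw [← mfderiv_eq_fderiv, mfderiv_comp z (hg _) d2, h0]
    rfl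
  have hc := (e.continuousAt_extend (I := I) hxe).preimage_mem_nhds (Metric.ball_mem_nhds _ hr)
  filter_upwards [hc, e.extend_source_mem_nhds (I := I) hxe] with y hy hy'
  have := Metric.isOpen_ball.is_const_of_fderiv_eq_zero (𝕜 := ℝ)
    (convex_ball (e.extend I x) r).isPreconnected
    (fun z hz ↦ (hd z (hball hz)).1.differentiableWithinAt) (fun z hz ↦ (hd z (hball hz)).2)
    hy (Metric.mem_ball_self hr)
  rwa [Function.comp_apply, Function.comp_apply, (e.extend I).left_inv hy',
    (e.extend I).left_inv hx] at this

end Charts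

/-! ### The pushed-forward normal spaces along a submanifold are parallel. -/

section Submanifold

variable {E : Type*} [NormedAddCommGroup E] [InnerProductSpace ℝ E] [FiniteDimensional ℝ E]
  {H : Type*} [TopologicalSpace H] {I : ModelWithCorners ℝ E H}
  {M : Type*} [TopologicalSpace M] [ChartedSpace H M] [IsManifold I ∞ M]
  {E' : Type*} [NormedAddCommGroup E'] [InnerProductSpace ℝ E'] [FiniteDimensional ℝ E']
  {H' : Type*} [TopologicalSpace H'] {J : ModelWithCorners ℝ E' H'}
  {L : Type*} [TopologicalSpace L] [ChartedSpace H' L] [IsManifold J ∞ L]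
  {F : Type*} [NormedAddCommGroup F] [InnerProductSpace ℝ F] [FiniteDimensional ℝ F]
  {f : M → F} {ι : L → M} {φ : M → E} {ψ : L → E'} {j : E' →L[ℝ] E} {y : L}

/-- The chain rule for `φ ∘ ι = j ∘ ψ`: in these coordinates the differential of `ι` is `j`. -/
theorem mfderiv_eq_coordField (hφ : IsCoordinateAt I φ (ι y)) (hψ : IsCoordinateAt J ψ y)
    (hι : MDifferentiableAt J I ι y) (hιj : φ ∘ ι =ᶠ[𝓝 y] j ∘ ψ) (u : TangentSpace J y) :
    mfderiv J I ι y u = coordField I φ (j (mfderiv J 𝓘(ℝ, E') ψ y u)) (ι y) := by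
  have h1 := mfderiv_comp y hφ.mdifferentiableAt hι
  have h2 := mfderiv_comp y j.differentiableAt.mdifferentiableAt hψ.mdifferentiableAt
  rw [← hιj.mfderiv_eq, h1, mfderiv_eq_fderiv, j.fderiv] at h2
  have h3 : mfderiv I 𝓘(ℝ, E) φ (ι y) (mfderiv J I ι y u) = j (mfderiv J 𝓘(ℝ, E') ψ y u) :=
    congr($h2 u)
  rw [← h3, hφ.coordField_mfderiv]

/-- Supplies the test fields for `IsTotallyGeodesic`: coordinate fields in directions `j b` are
defined on `M` and tangent to `L` near `y`. -/
theorem mem_tangentSubspace_iff (hφ : IsCoordinateAt I φ (ι y)) (hψ : IsCoordinateAt J ψ y)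
    (hι : MDifferentiableAt J I ι y) (hιj : φ ∘ ι =ᶠ[𝓝 y] j ∘ ψ) (w : TangentSpace I (ι y)) :
    w ∈ tangentSubspace I J ι y ↔ ∃ b, coordField I φ (j b) (ι y) = w := by
  constructor
  · rintro ⟨u, rfl⟩
    exact ⟨_, (mfderiv_eq_coordField hφ hψ hι hιj u).symm⟩
  · rintro ⟨b, rfl⟩
    refine ⟨coordField J ψ b y, (mfderiv_eq_coordField hφ hψ hι hιj _).trans ?_⟩
    rw [hψ.mfderiv_coordField]

theorem injective_mfderiv_of_coord (hφ : IsCoordinateAt I φ (ι y)) (hψ : IsCoordinateAt J ψ y)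
    (hι : MDifferentiableAt J I ι y) (hιj : φ ∘ ι =ᶠ[𝓝 y] j ∘ ψ) (hj : Function.Injective j) :
    Function.Injective (mfderiv J I ι y) := by
  intro u u' huu
  rw [mfderiv_eq_coordField hφ hψ hι hιj, mfderiv_eq_coordField hφ hψ hι hιj] at huu
  have h1 := congrArg (mfderiv I 𝓘(ℝ, E) φ (ι y)) huu
  rw [hφ.mfderiv_coordField, hφ.mfderiv_coordField] at h1
  rw [← hψ.coordField_mfderiv u, hj h1, hψ.coordField_mfderiv]

variable (I J) in
/-- The orthogonal projection of `F` onto the image under `f` of the normal space of the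
submanifold `ι` in `M`. -/
def pushforwardNormalProjection (f : M → F) (ι : L → M) (y : L) : F →L[ℝ] F :=
  (mvfderiv I f (ι y)).range.starProjection -
    ((tangentSubspace I J ι y).map (mvfderiv I f (ι y)).toLinearMap).starProjection

variable [RiemannianBundle (fun x : M ↦ TangentSpace I x)]
  [IsContMDiffRiemannianBundle I ∞ E (fun x : M ↦ TangentSpace I x)]

theorem IsIsometricImmersion.injective_mvfderiv (hf : IsIsometricImmersion I f) (x : M) :
    Function.Injective (mvfderiv I f x) := by
  rw [injective_iff_map_eq_zero]
  intro v hv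
  rw [← inner_self_eq_zero (𝕜 := ℝ), ← hf.inner_eq, hv, inner_zero_left]

/-- If a totally geodesic submanifold is invariant under the shape operators of `f`, then the image
under `f` of its normal spaces is parallel. -/
theorem mfderiv_pushforwardNormalProjection_eq_zero {h : E → F} (hf : IsIsometricImmersion I f)
    (hφ : ∀ᶠ x in 𝓝 (ι y), IsCoordinateAt I φ x) (hψ : ∀ᶠ y' in 𝓝 y, IsCoordinateAt J ψ y')
    (hι : ContMDiff J I ∞ ι) (hιj : φ ∘ ι =ᶠ[𝓝 y] j ∘ ψ) (hj : Function.Injective j)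
    (hfh : f =ᶠ[𝓝 (ι y)] h ∘ φ) (hh : ContDiffAt ℝ ∞ h (φ (ι y)))
    (hgeo : IsTotallyGeodesic I J ι)
    (hadapted : ∀ ξ, ∀ X ∈ tangentSubspace I J ι y,
      shapeOperator (secondFundamentalForm f hf.contMDiff (ι y)) ξ X ∈ tangentSubspace I J ι y) :
    MDifferentiableAt J 𝓘(ℝ, F →L[ℝ] F) (pushforwardNormalProjection I J f ι) y ∧
      mfderiv J 𝓘(ℝ, F →L[ℝ] F) (pushforwardNormalProjection I J f ι) y = 0 := by
  have hφy := hφ.self_of_nhds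
  have hψy := hψ.self_of_nhds
  have hιd (y' : L) : MDifferentiableAt J I ι y' := (hι y').mdifferentiableAt (by simp)
  have hyj : φ (ι y) = j (ψ y) := hιj.self_of_nhds
  have hιt : Filter.Tendsto ι (𝓝 y) (𝓝 (ι y)) := hι.continuous.continuousAt
  have hh1 : ∀ᶠ x in 𝓝 (ι y), DifferentiableAt ℝ h (φ x) :=
    hφy.contMDiffAt.continuousAt.eventually <|
      ((hh.of_le (m := 1) (by exact_mod_cast le_top)).eventually (by simp)).mono
        fun _ h ↦ h.differentiableAt one_ne_zero
  have hdf : ∀ᶠ x in 𝓝 (ι y), ∀ v, mvfderiv I f x (coordField I φ v x) = fderiv ℝ h (φ x) v := by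
    filter_upwards [hφ, hfh.eventuallyEq_nhds, hh1] with x h1 h2 h3
    exact h1.mvfderiv_coordField h2 h3
  have hdfy := hdf.self_of_nhds
  -- In coordinates `f_* TM` and `f_* TL` are the ranges of `A u = Dh (j u)` and of `A u ∘ j`, at `u
  -- = ψ y'`.
  have hQ : pushforwardNormalProjection I J f ι =ᶠ[𝓝 y] fun y' ↦
      (fun u ↦ (fderiv ℝ h (j u)).range.starProjection -
        (fderiv ℝ h (j u) ∘L j).range.starProjection) (ψ y') := by
    filter_upwards [hιt.eventually hφ, hψ, hιt.eventually hdf, hιj.eventuallyEq_nhds]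
      with y' h1 h2 h3 h4
    have h5 : φ (ι y') = j (ψ y') := h4.self_of_nhds
    rw [h5] at h3
    have h6 : (mvfderiv I f (ι y')).range = (fderiv ℝ h (j (ψ y'))).range := by
      refine le_antisymm ?_ ?_
      · rintro _ ⟨v, rfl⟩
        refine ⟨mfderiv I 𝓘(ℝ, E) φ (ι y') v, (h3 _).symm.trans ?_⟩
        rw [h1.coordField_mfderiv]
        rfl
      · rintro _ ⟨v, rfl⟩
        exact ⟨_, h3 v⟩
    have h7 : (tangentSubspace I J ι y').map (mvfderiv I f (ι y')).toLinearMap =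
        (fderiv ℝ h (j (ψ y')) ∘L j).range := by
      refine le_antisymm ?_ ?_
      · rintro _ ⟨v, hv, rfl⟩
        obtain ⟨b, rfl⟩ := (mem_tangentSubspace_iff h1 h2 (hιd y') h4 _).mp hv
        exact ⟨b, (h3 _).symm⟩
      · rintro _ ⟨b, rfl⟩
        exact ⟨_, (mem_tangentSubspace_iff h1 h2 (hιd y') h4 _).mpr ⟨b, rfl⟩, h3 _⟩
    simp only [pushforwardNormalProjection, h6, h7]
  have hA2 : DifferentiableAt ℝ (fderiv ℝ h) (j (ψ y)) := hyj ▸ hh.differentiableAt_fderiv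
  have hA : HasFDerivAt (fun u ↦ fderiv ℝ h (j u))
      (fderiv ℝ (fderiv ℝ h) (j (ψ y)) ∘L j) (ψ y) :=
    hA2.hasFDerivAt.comp (ψ y) j.hasFDerivAt
  have hinj : Function.Injective (fderiv ℝ h (j (ψ y))) := by
    intro v w hvw
    rw [← hyj, ← hdfy, ← hdfy] at hvw
    have h1 := congrArg (mfderiv I 𝓘(ℝ, E) φ (ι y)) (hf.injective_mvfderiv _ hvw)
    rwa [hφy.mfderiv_coordField, hφy.mfderiv_coordField] at h1
  have hinj' : ∀ᶠ u in 𝓝 (ψ y), Function.Injective (fderiv ℝ h (j u)) :=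
    hA.continuousAt.eventually (ContinuousLinearMap.isOpen_injective.mem_nhds hinj)
  -- By isometry, orthogonality to `f_* TL` in `F` is orthogonality to `TL` in `M`.
  have htan (w : E)
      (hw : ∀ v', ⟪fderiv ℝ h (j (ψ y)) w, fderiv ℝ h (j (ψ y)) (j v')⟫_ℝ = 0) (c)
      (hc : c ∈ tangentSubspace I J ι y) : ⟪c, coordField I φ w (ι y)⟫_ℝ = 0 := by
    obtain ⟨v', rfl⟩ := (mem_tangentSubspace_iff hφy hψy (hιd y) hιj _).mp hc
    rw [real_inner_comm, ← hf.inner_eq, hdfy, hdfy, hyj, hw]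
  have hR := fderiv_starProjection_range_sub_eq_zero hA.differentiableAt hinj' hj
    -- Here `⟪D²h (j b, j v), Dh w⟫` is `⟪∇_b v, w⟫` for the coordinate fields, and `∇_b v` is
    -- tangent to `L` since `L` is totally geodesic.
    (fun b v w hw ↦ by
      rw [hA.fderiv, ContinuousLinearMap.comp_apply, ← hyj,
        ← inner_leviCivita_coordField hφ hf hfh hh]
      refine htan w hw _ (hgeo y _ ?_ ?_ _
        ((mem_tangentSubspace_iff hφy hψy (hιd y) hιj _).mpr ⟨b, rfl⟩))
      · filter_upwards [hφ] with x hx using hx.contMDiffAt_coordField _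
      · filter_upwards [hιt.eventually hφ, hψ, hιj.eventuallyEq_nhds] with y' h1 h2 h4
        exact (mem_tangentSubspace_iff h1 h2 (hιd y') h4 _).mpr ⟨v, rfl⟩)
    -- Here `⟪α(b, w), ξ⟫ = ⟪A_ξ b, w⟫ = 0` for every `ξ`, so `D²h (j b, w)` has no normal part and
    -- lies in `f_* TM`.
    (fun b w hw ↦ by
      have h1 : secondFundamentalForm f hf.contMDiff (ι y) (coordField I φ (j b) (ι y))
          (coordField I φ w (ι y)) = 0 := by
        refine ext_inner_right ℝ fun ξ ↦ ?_
        rw [← inner_shapeOperator, inner_zero_left]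
        exact htan w hw _ (hadapted ξ _
          ((mem_tangentSubspace_iff hφy hψy (hιd y) hιj _).mpr ⟨b, rfl⟩))
      rw [secondFundamentalForm_coordField hφ hf.contMDiff hfh hh,
        Submodule.orthogonalProjectionOnto_eq_zero_iff, normalSpace,
        Submodule.orthogonal_orthogonal] at h1
      obtain ⟨v, hv⟩ := h1
      rw [hA.fderiv, ContinuousLinearMap.comp_apply, ← hyj, ← hv]
      refine ⟨mfderiv I 𝓘(ℝ, E) φ (ι y) v, (hdfy _).symm.trans ?_⟩
      rw [hφy.coordField_mfderiv]
      rfl)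
  have hcomp := hψy.mvfderiv_comp hR.1
  refine ⟨hcomp.1.congr_of_eventuallyEq hQ, ?_⟩
  rw [hQ.mfderiv_eq]
  ext1 v
  have h1 := hcomp.2 (mfderiv J 𝓘(ℝ, E') ψ y v)
  rw [hψy.coordField_mfderiv, hR.2] at h1
  exact h1

end Submanifold

/-! ### Reduction of codimension. -/

section Reduction

variable {E : Type*} [NormedAddCommGroup E] [InnerProductSpace ℝ E] [FiniteDimensional ℝ E]
  {H : Type*} [TopologicalSpace H] {I : ModelWithCorners ℝ E H} [I.Boundaryless]
  {M : Type*} [TopologicalSpace M] [ChartedSpace H M] [IsManifold I ∞ M]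
  {E' : Type*} [NormedAddCommGroup E'] [InnerProductSpace ℝ E'] [FiniteDimensional ℝ E']
  {H' : Type*} [TopologicalSpace H'] {J : ModelWithCorners ℝ E' H'} [J.Boundaryless]
  {L : Type*} [TopologicalSpace L] [ChartedSpace H' L] [IsManifold J ∞ L]
  {F : Type*} [NormedAddCommGroup F] [InnerProductSpace ℝ F] [FiniteDimensional ℝ F]
  {f : M → F} {ι : L → M}

/-- Around every point, an immersion is an injective linear map in suitable coordinates. -/
theorem exists_coordinates_of_isImmersion (hι : IsImmersion J I ∞ ι) (y : L) :
    ∃ (φ : M → E) (ψ : L → E') (j : E' →L[ℝ] E) (σ : E → M),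
      (∀ᶠ x in 𝓝 (ι y), IsCoordinateAt I φ x) ∧ (∀ᶠ y' in 𝓝 y, IsCoordinateAt J ψ y') ∧
      Function.Injective j ∧ φ ∘ ι =ᶠ[𝓝 y] j ∘ ψ ∧ σ ∘ φ =ᶠ[𝓝 (ι y)] id ∧
      ContMDiffAt 𝓘(ℝ, E) I ∞ σ (φ (ι y)) := by
  have h := hι.isImmersionAt y
  have hs := h.codChart.extend_source_mem_nhds (I := I) h.mem_codChart_source
  have ht := h.domChart.extend_source_mem_nhds (I := J) h.mem_domChart_source
  -- The map `j` is the inclusion of the first factor in the local normal form of an immersion.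
  refine ⟨h.codChart.extend I, h.domChart.extend J,
    h.equiv.toContinuousLinearMap ∘L ContinuousLinearMap.inl ℝ E' h.complement,
    (h.codChart.extend I).symm, ?_, ?_, ?_, ?_, ?_, ?_⟩
  · filter_upwards [hs] with x hx
    exact isCoordinateAt_extend h.codChart_mem_maximalAtlas (by rwa [h.codChart.extend_source] at hx)
  · filter_upwards [ht] with x hx
    exact isCoordinateAt_extend h.domChart_mem_maximalAtlas (by rwa [h.domChart.extend_source] at hx)
  · exact h.equiv.injective.comp fun a b hab ↦ congrArg Prod.fst hab
  · filter_upwards [ht] with y' hy'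
    have h1 := h.writtenInCharts ((h.domChart.extend J).map_source hy')
    simp only [Function.comp_apply, (h.domChart.extend J).left_inv hy'] at h1
    exact h1
  · filter_upwards [hs] with x hx
    exact (h.codChart.extend I).left_inv hx
  · refine contMDiffAt_extend_symm h.codChart_mem_maximalAtlas
      ((h.codChart.extend I).map_source ?_)
    rw [h.codChart.extend_source]
    exact h.mem_codChart_source

theorem finrank_tangentSubspace (hι : IsImmersion J I ∞ ι) (y : L) :
    Module.finrank ℝ (tangentSubspace I J ι y) = Module.finrank ℝ E' := by
  obtain ⟨φ, ψ, j, -, hφ, hψ, hj, hιj, -⟩ := exists_coordinates_of_isImmersion hι y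
  exact LinearMap.finrank_range_of_inj (injective_mfderiv_of_coord hφ.self_of_nhds
    hψ.self_of_nhds ((hι.contMDiff y).mdifferentiableAt (by simp)) hιj hj)

variable [RiemannianBundle (fun x : M ↦ TangentSpace I x)]
  [IsContMDiffRiemannianBundle I ∞ E (fun x : M ↦ TangentSpace I x)]

/-- A connected totally geodesic submanifold that is invariant under the shape operators of an
isometric immersion `f` is mapped by `f` into an affine subspace, whose codimension is that of the
submanifold. -/
theorem exists_affineSubspace_of_isTotallyGeodesic [ConnectedSpace L]
    (hf : IsIsometricImmersion I f) (hι : IsImmersion J I ∞ ι) (hgeo : IsTotallyGeodesic I J ι)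
    (hadapted : ∀ y, ∀ ξ, ∀ X ∈ tangentSubspace I J ι y,
      shapeOperator (secondFundamentalForm f hf.contMDiff (ι y)) ξ X ∈ tangentSubspace I J ι y) :
    ∃ S : AffineSubspace ℝ F, (S : Set F).Nonempty ∧
      Module.finrank ℝ S.direction + Module.finrank ℝ E =
        Module.finrank ℝ F + Module.finrank ℝ E' ∧ ∀ y : L, f (ι y) ∈ S := by
  have hιs := hι.contMDiff
  obtain ⟨y₀⟩ : Nonempty L := inferInstance
  have hQ (y : L) : MDifferentiableAt J 𝓘(ℝ, F →L[ℝ] F) (pushforwardNormalProjection I J f ι) y ∧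
      mfderiv J 𝓘(ℝ, F →L[ℝ] F) (pushforwardNormalProjection I J f ι) y = 0 := by
    obtain ⟨φ, ψ, j, σ, hφ, hψ, hj, hιj, hσφ, hσ⟩ := exists_coordinates_of_isImmersion hι y
    refine mfderiv_pushforwardNormalProjection_eq_zero (h := f ∘ σ) hf hφ hψ hιs hιj hj ?_ ?_ hgeo
      (hadapted y)
    · filter_upwards [hσφ] with x hx
      exact congrArg f hx.symm
    · exact ((hf.contMDiff _).comp _ hσ).contDiffAt
  have hconst (y : L) := eq_of_mfderiv_eq_zero (fun y ↦ (hQ y).1) (fun y ↦ (hQ y).2) y y₀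
  let T (y : L) : Submodule ℝ F := (mvfderiv I f (ι y)).range
  let S (y : L) : Submodule ℝ F :=
    (tangentSubspace I J ι y).map (mvfderiv I f (ι y)).toLinearMap
  have hST (y : L) : S y ≤ T y := LinearMap.map_le_range
  have hinj (y : L) := hf.injective_mvfderiv (ι y)
  -- The space `(S y₀)ᗮ ⊓ T y₀` is the constant `K`, so the affine subspace is the translate of `Kᗮ`
  -- through `f (ι y₀)`.
  refine ⟨AffineSubspace.mk' (f (ι y₀)) ((S y₀)ᗮ ⊓ T y₀)ᗮ, AffineSubspace.mk'_nonempty _ _, ?_,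
    fun y ↦ ?_⟩
  · have h1 := Submodule.finrank_add_inf_finrank_orthogonal (hST y₀)
    have h2 := ((S y₀)ᗮ ⊓ T y₀).finrank_add_finrank_orthogonal
    have h3 : Module.finrank ℝ (T y₀) = Module.finrank ℝ E :=
      LinearMap.finrank_range_of_inj (hinj y₀)
    have h4 : Module.finrank ℝ (S y₀) = Module.finrank ℝ E' := by
      rw [← finrank_tangentSubspace hι y₀]
      exact LinearEquiv.finrank_eq (Submodule.equivMapOfInjective _ (hinj y₀) _).symm
    rw [AffineSubspace.direction_mk']
    omega
  · rw [AffineSubspace.mem_mk', vsub_eq_sub, Submodule.mem_orthogonal]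
    intro k hk
    rw [inner_sub_right, sub_eq_zero]
    -- The projection at `y` equals that at `y₀`, so it also fixes `k`.
    have hk' (y : L) : k ∈ T y ⊓ (S y)ᗮ := by
      have h1 := starProjection_sub_eq_self (x := k) (S := S y₀) (T := T y₀) ⟨hk.2, hk.1⟩
      have h2 : ((T y).starProjection - (S y).starProjection) k = k :=
        (congr($(hconst y) k)).trans h1
      rw [← h2]
      exact starProjection_sub_apply_mem (hST y) k
    have hfd (y) : MDifferentiableAt I 𝓘(ℝ, F) f (ι y) :=
      (hf.contMDiff _).mdifferentiableAt (by simp)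
    have hιd (y) : MDifferentiableAt J I ι y := (hιs y).mdifferentiableAt (by simp)
    have hkd (y) : MDifferentiableAt 𝓘(ℝ, F) 𝓘(ℝ, ℝ) (innerSL ℝ k) (f (ι y)) :=
      (innerSL ℝ k).differentiableAt.mdifferentiableAt
    -- The height function `⟪k, f ∘ ι⟫` has derivative `⟪k, f_* ι_* u⟫`, zero because `k ⊥ S y`.
    refine eq_of_mfderiv_eq_zero (I := J) (g := innerSL ℝ k ∘ f ∘ ι)
      (fun y ↦ (hkd y).comp y ((hfd y).comp y (hιd y))) (fun y ↦ ?_) y y₀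
    ext u
    rw [mfderiv_comp y (hkd y) ((hfd y).comp y (hιd y)), mfderiv_comp y (hfd y) (hιd y),
      mfderiv_eq_fderiv, ContinuousLinearMap.fderiv]
    change ⟪k, mvfderiv I f (ι y) (mfderiv J I ι y u)⟫_ℝ = 0
    rw [real_inner_comm]
    exact (hk' y).2 _ ⟨_, ⟨u, rfl⟩, rfl⟩

end Reduction

end

theorem proposition3 {n p l : ℕ}
    {M : Type*} [TopologicalSpace M] [ChartedSpace (EuclideanSpace ℝ (Fin n)) M]
    [IsManifold (𝓡 n) ∞ M] [RiemannianBundle (fun x : M ↦ TangentSpace (𝓡 n) x)]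
    [IsContMDiffRiemannianBundle (𝓡 n) ∞ (EuclideanSpace ℝ (Fin n))
      (fun x : M ↦ TangentSpace (𝓡 n) x)]
    {L : Type*} [TopologicalSpace L] [ConnectedSpace L]
    [ChartedSpace (EuclideanSpace ℝ (Fin l)) L] [IsManifold (𝓡 l) ∞ L]
    (f : M → EuclideanSpace ℝ (Fin (n + p))) (hf : IsIsometricImmersion (𝓡 n) f)
    (ι : L → M) (hι : IsImmersion (𝓡 l) (𝓡 n) ∞ ι)
    (hgeo : IsTotallyGeodesic (𝓡 n) (𝓡 l) ι)
    (hadapted : ∀ y : L, IsAdapted (secondFundamentalForm f hf.contMDiff (ι y))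
      ![tangentSubspace (𝓡 n) (𝓡 l) ι y, (tangentSubspace (𝓡 n) (𝓡 l) ι y)ᗮ]) :
    AdmitsReductionOfCodimension l (f ∘ ι) p := by
  -- Index `0` of the decomposition is the tangent space of `L`.
  obtain ⟨S, hS, hdim, hmem⟩ := exists_affineSubspace_of_isTotallyGeodesic hf hι hgeo
    fun y ↦ hadapted y 0
  refine ⟨S, hS, ?_, hmem⟩
  rw [finrank_euclideanSpace_fin, finrank_euclideanSpace_fin, finrank_euclideanSpace_fin] at hdim
  omega
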